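/- Let $\Gamma$ be a finite simple graph with vertex set $V(\Gamma)$, and let $A_\Gamma = \langle V(\Gamma) \mid uv = vu \text{ for every edge } \{u,v\} \text{ of } \Gamma\rangle$ be the associated right-angled Artin group. Let $\phi \in \mathrm{Aut}(A_\Gamma)$ be a finite composition of inversions, an inversion being an automorphism that sends $x \mapsto x^{-1}$ for one vertex $x$ and fixes all other vertices. Let $m \geq 1$ be an integer with $\phi^m = 1$, and let $$A_\phi = A_\Gamma \rtimes_\phi \langle t \rangle = \langle V(\Gamma), t \mid uv = vu \ (\{u,v\} \in E(\Gamma)),\ t^m = 1,\ t^{-1} s t = \phi(s) \ (s \in V(\Gamma)) \rangle .$$ Let $\widehat{X} = V(\Gamma)^{\pm 1} \cup \{t, t^{-1}\}$ be the standard (inverse-closed) generating set of $A_\phi$. For $g \in A_\phi$ let $|g|$ be the length of a shortest word over $\widehat{X}$ representing $g$, and let $|g|_c = \min\{|h| : h \text{ conjugate to } g\}$. Then the conjugacy geodesic language $$\mathsf{ConjGeo}(A_\phi, \widehat{X}) = \{ w \in \widehat{X}^{*} : l(w) = |\pi(w)|_c \}$$ is regular, where $l(w)$ is the length of the word $w$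 and $\pi(w) \in A_\phi$ is the element that it represents. -/

import Mathlib

/-! ### Languages of words over a generating set of a group -/

section Languages

variable {G : Type*} [Group G]

/-- The natural projection `π : X* → G`: a word over the set `X` of elements of `G`
is sent to the product of its letters. -/
def wordEval (X : Set G) (w : List X) : G := (w.map Subtype.val).prod

/-- The length `|g|_X` of `g`: the length of a shortest word over `X` representing `g`. -/
noncomputable def wordLength (X : Set G) (g : G) : ℕ :=
  sInf {n : ℕ | ∃ w : List X, wordEval X w = g ∧ w.length = n}

/-- The length up to conjugacy `|g|_c`: the least length of an element conjugate to `g`. -/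
noncomputable def conjLength (X : Set G) (g : G) : ℕ :=
  sInf {n : ℕ | ∃ h : G, IsConj g h ∧ wordLength X h = n}

/-- The conjugacy geodesic language `ConjGeo(G, X)`: all words over `X` whose length is equal to
the length up to conjugacy of the element that they represent. -/
def ConjGeo (X : Set G) : Language X :=
  {w : List X | w.length = conjLength X (wordEval X w)}

end Languages

/-! ### Right-angled Artin groups and compositions of inversions -/

section RAAG

variable {V : Type*}

/-- The defining relators of the right-angled Artin group of `Γ`: adjacent vertices commute. -/
def raagRels (Γ : SimpleGraph V) : Set (FreeGroup V) :=
  {r | ∃ u v : V, Γ.Adj u v ∧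
    r = FreeGroup.of u * FreeGroup.of v * (FreeGroup.of u)⁻¹ * (FreeGroup.of v)⁻¹}

/-- The right-angled Artin group `A_Γ = ⟨ V(Γ) | uv = vu for every edge {u, v} of Γ ⟩`. -/
abbrev RAAG (Γ : SimpleGraph V) : Type _ := PresentedGroup (raagRels Γ)

/-- The generator of `A_Γ` given by a vertex. -/
def RAAG.gen (Γ : SimpleGraph V) (v : V) : RAAG Γ := PresentedGroup.of v

/-- `φ` is an inversion: it inverts one vertex generator and fixes all the others. -/
def IsInversion {Γ : SimpleGraph V} (φ : MulAut (RAAG Γ)) : Prop :=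
  ∃ x : V, φ (RAAG.gen Γ x) = (RAAG.gen Γ x)⁻¹ ∧
    ∀ y : V, y ≠ x → φ (RAAG.gen Γ y) = RAAG.gen Γ y

/-- `φ` is a finite composition of inversions. -/
def IsCompositionOfInversions {Γ : SimpleGraph V} (φ : MulAut (RAAG Γ)) : Prop :=
  ∃ l : List (MulAut (RAAG Γ)), (∀ ψ ∈ l, IsInversion ψ) ∧ φ = l.prod

end RAAG

/-! ### The extension of a group by a finite cyclic group -/

section Extension

/-- For an automorphism `φ` of `N` with `φ ^ m = 1`, the action of the cyclic group
`⟨t⟩ = ℤ/m` on `N` in which the generator `t` acts as `φ⁻¹`. In the semidirect product `t` acts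
by `s ↦ t s t⁻¹`, so that `t⁻¹ s t = φ s`. -/
def cyclicAction {N : Type*} [Group N] (m : ℕ) (φ : MulAut N) (hφ : φ ^ m = 1) :
    Multiplicative (ZMod m) →* MulAut N :=
  AddMonoidHom.toMultiplicativeLeft
    (ZMod.lift m ⟨zmultiplesHom (Additive (MulAut N)) (Additive.ofMul φ⁻¹), by
      simp [← ofMul_pow, hφ]⟩)

theorem cyclicAction_ofAdd_one {N : Type*} [Group N] (m : ℕ) (φ : MulAut N) (hφ : φ ^ m = 1) :
    cyclicAction m φ hφ (Multiplicative.ofAdd 1) = φ⁻¹ := by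
  have h := ZMod.lift_coe m
    ⟨zmultiplesHom (Additive (MulAut N)) (Additive.ofMul φ⁻¹), by simp [← ofMul_pow, hφ]⟩ 1
  rw [Int.cast_one] at h
  change Additive.toMul (ZMod.lift m _ 1) = _
  rw [h]
  simp

variable {V : Type*} {Γ : SimpleGraph V}

/-- The virtual right-angled Artin group
`A_φ = A_Γ ⋊_φ ⟨t⟩ = ⟨ V(Γ), t | R(A_Γ), t ^ m = 1, t⁻¹ s t = φ s ⟩`, where `φ ^ m = 1`. -/
abbrev VirtualRAAG (m : ℕ) (φ : MulAut (RAAG Γ)) (hφ : φ ^ m = 1) : Type _ :=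
  RAAG Γ ⋊[cyclicAction m φ hφ] Multiplicative (ZMod m)

namespace VirtualRAAG

variable (m : ℕ) (φ : MulAut (RAAG Γ)) (hφ : φ ^ m = 1)

/-- The generator of `A_φ` given by a vertex of `Γ`. -/
def s (v : V) : VirtualRAAG m φ hφ := SemidirectProduct.inl (RAAG.gen Γ v)

/-- The generator `t` of the finite cyclic factor of `A_φ`. -/
def t : VirtualRAAG m φ hφ := SemidirectProduct.inr (Multiplicative.ofAdd 1)

/-- The standard generating set of `A_φ`: the vertices of `Γ` and `t`, together with their
inverses. -/
def stdGen : Set (VirtualRAAG m φ hφ) :=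
  {g | (∃ v : V, g = s m φ hφ v ∨ g = (s m φ hφ v)⁻¹) ∨ g = t m φ hφ ∨ g = (t m φ hφ)⁻¹}

theorem t_pow : t m φ hφ ^ m = 1 := by
  rw [t, ← map_pow, ← ofAdd_nsmul]
  simp

theorem t_inv_mul_mul_t (g : RAAG Γ) :
    (t m φ hφ)⁻¹ * SemidirectProduct.inl g * t m φ hφ = SemidirectProduct.inl (φ g) := by
  have h := SemidirectProduct.inl_aut_inv (φ := cyclicAction m φ hφ) (Multiplicative.ofAdd 1) g
  rw [cyclicAction_ofAdd_one, inv_inv] at h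
  rw [h, t, map_inv]

/-- Every element of `A_φ` is represented by a word over the standard generating set. -/
theorem closure_stdGen [NeZero m] : Submonoid.closure (stdGen m φ hφ) = ⊤ := by
  have hinv : (stdGen m φ hφ)⁻¹ = stdGen m φ hφ := by
    ext g
    simp only [stdGen, Set.mem_inv, Set.mem_ofPred_eq, inv_eq_iff_eq_inv]
    constructor
    · rintro (⟨v, h | h⟩ | h | h)
      · exact Or.inl ⟨v, Or.inr h⟩
      · exact Or.inl ⟨v, Or.inl (by simpa using h)⟩
      · exact Or.inr (Or.inr h)
      · exact Or.inr (Or.inl (by simpa using h))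
    · rintro (⟨v, h | h⟩ | h | h)
      · exact Or.inl ⟨v, Or.inr (by simpa using h)⟩
      · exact Or.inl ⟨v, Or.inl h⟩
      · exact Or.inr (Or.inr (by simpa using h))
      · exact Or.inr (Or.inl h)
  have key : Subgroup.closure (stdGen m φ hφ) = ⊤ := by
    rw [eq_top_iff]
    rintro g -
    rw [← SemidirectProduct.inl_left_mul_inr_right g]
    refine mul_mem ?_ ?_
    · have : (⊤ : Subgroup (RAAG Γ)) ≤
          (Subgroup.closure (stdGen m φ hφ)).comap SemidirectProduct.inl := by
        rw [← PresentedGroup.closure_range_of, Subgroup.closure_le]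
        rintro _ ⟨v, rfl⟩
        refine Subgroup.subset_closure ?_
        exact Or.inl ⟨v, Or.inl rfl⟩
      exact this (Subgroup.mem_top g.left)
    · have h : g.right = Multiplicative.ofAdd (1 : ZMod m) ^ (Multiplicative.toAdd g.right).val := by
        rw [← ofAdd_nsmul]
        simp
      rw [h, map_pow]
      refine pow_mem (Subgroup.subset_closure ?_) _
      exact Or.inr (Or.inl rfl)
  have h2 := Subgroup.closure_toSubmonoid (stdGen m φ hφ)
  rw [hinv, Set.union_self, key] at h2
  rw [← h2]
  rfl

end VirtualRAAG

end Extension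

/-!
Write `A = A_Γ` and let `τ` be the generator of the cyclic group. Every `k` in the cyclic group acts
on `A` by `v ↦ v ^ f v k`, where each `f v` is a character with values in `{1, -1}`
(`exists_characters`). So letters `τ ^ e` can be moved through a word without changing the number
of its other letters, and a word `w` represents `a k` with `a ∈ A` given by the word `untwist f τ w`
of its vertex letters, and `k = tExp τ w`. Conjugation in the extension acts on the first factor by
`a ↦ b (l • a) (ψ b)⁻¹`, where `ψ` is the involutive automorphism `v ↦ v ^ f v k`.

The criterion `isConjGeodesic_iff` says that `w` is a conjugacy geodesic if and only if it has the
least possible number of letters `τ ^ e` for its image in the cyclic group, and no cyclic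
permutation of `w` contains two letters of the same vertex `v` that cancel after the letters between
them, all of which commute with `v` or are powers of `τ`, are moved away. Both conditions are
regular: the second one excludes the cyclic shift of a finite union of concatenations of simple
regular languages.

Necessity is clear: a cancellation shortens the word, and after the letters `τ ^ e` have been moved
to the right end they can be replaced by any other word with the same image. Sufficiency has two
ingredients.

* A reduced word in a right-angled Artin group is geodesic (`IsReducedWord.length_le`). The group
  acts on configurations of stacks, one for each vertex, in such a way that each letter of a reduced
  word adds one letter to the empty configuration, and no word adds more letters than its length.

* A reduced word `w` that is also `ψ`-cyclically reduced is shortest in its `ψ`-twisted conjugacy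
  class (`length_le_of_twistedConj`). If all the words `w (ψ w) w (ψ w) ⋯` are reduced, this
  follows by comparing the growth of the powers of `a ψ(a)` and of its conjugate `h ψ(h)`, where
  `h = b a (ψ b)⁻¹`. The only obstruction to their reducedness are vertices inverted by `ψ` that
  occur exactly once in `w` and commute with the rest of `w`. These vertices are killed by a
  retraction before growth is compared, and they are accounted for separately: their exponent sums
  modulo 2 are invariant under `ψ`-twisted conjugation, so that they occur in every word for `h`.
-/

/-! ### Closure properties of regular languages -/

namespace Language

variable {α : Type*}

theorem IsRegular.congr {L L' : Language α} (h : L.IsRegular) (e : ∀ w, w ∈ L' ↔ w ∈ L) :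
    L'.IsRegular := by
  rwa [show L' = L from Set.ext e]

/-- The state of the automaton for `L₁ * L₂` is the state of an automaton for `L₁` together with
the set of the states that an automaton for `L₂` has reached from the split points read so far. -/
theorem IsRegular.mul {L₁ L₂ : Language α} (h₁ : L₁.IsRegular) (h₂ : L₂.IsRegular) :
    (L₁ * L₂).IsRegular := by
  classical
  obtain ⟨σ₁, _, M₁, rfl⟩ := h₁
  obtain ⟨σ₂, _, M₂, rfl⟩ := h₂
  let ext : σ₁ × Set σ₂ → Set σ₂ := fun q => q.2 ∪ {s | q.1 ∈ M₁.accept ∧ s = M₂.start}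
  let M : DFA α (σ₁ × Set σ₂) :=
    { step := fun q a => (M₁.step q.1 a, (fun s => M₂.step s a) '' ext q)
      start := (M₁.start, ∅)
      accept := {q | ∃ s ∈ ext q, s ∈ M₂.accept} }
  have key : ∀ (w : List α) (q : σ₁ × Set σ₂), w ∈ M.acceptsFrom q ↔
      (∃ s ∈ q.2, w ∈ M₂.acceptsFrom s) ∨
        ∃ a b, w = a ++ b ∧ a ∈ M₁.acceptsFrom q.1 ∧ b ∈ M₂.accepts := by
    intro w
    induction w with
    | nil =>
      rintro ⟨q, S⟩
      simp only [DFA.mem_acceptsFrom, DFA.evalFrom_nil, M, ext, Set.mem_ofPred_eq, Set.mem_union,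
        DFA.mem_accepts, List.nil_eq, List.append_eq_nil_iff]
      constructor
      · rintro ⟨s, hs | ⟨hq, rfl⟩, ha⟩
        · exact Or.inl ⟨s, hs, ha⟩
        · exact Or.inr ⟨[], [], ⟨rfl, rfl⟩, hq, ha⟩
      · rintro (⟨s, hs, ha⟩ | ⟨_, _, ⟨rfl, rfl⟩, hq, ha⟩)
        · exact ⟨s, Or.inl hs, ha⟩
        · exact ⟨_, Or.inr ⟨hq, rfl⟩, ha⟩
    | cons x w ih =>
      rintro ⟨q, S⟩
      have h := ih (M.step (q, S) x)
      rw [DFA.mem_acceptsFrom] at h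
      rw [DFA.mem_acceptsFrom, DFA.evalFrom_cons, h]
      constructor
      · rintro (⟨_, ⟨s, hs | ⟨hq, rfl⟩, rfl⟩, ha⟩ | ⟨a, b, rfl, ha, hb⟩)
        · exact Or.inl ⟨s, hs, ha⟩
        · exact Or.inr ⟨[], x :: w, rfl, hq, ha⟩
        · exact Or.inr ⟨x :: a, b, rfl, ha, hb⟩
      · rintro (⟨s, hs, ha⟩ | ⟨a, b, hw, ha, hb⟩)
        · exact Or.inl ⟨_, ⟨s, Or.inl hs, rfl⟩, ha⟩
        · cases a with
          | nil =>
            subst hw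
            exact Or.inl ⟨_, ⟨_, Or.inr ⟨ha, rfl⟩, rfl⟩, hb⟩
          | cons y a =>
            obtain ⟨rfl, rfl⟩ := List.cons_eq_cons.mp hw
            exact Or.inr ⟨a, b, rfl, ha, hb⟩
  refine (isRegular_iff).2 ⟨σ₁ × Set σ₂, Fintype.ofFinite _, M, ?_⟩
  ext w
  rw [Language.mem_mul]
  refine (key w _).trans ?_
  constructor
  · rintro (⟨s, hs, -⟩ | ⟨a, b, rfl, ha, hb⟩)
    · exact hs.elim
    · exact ⟨a, ha, b, hb, rfl⟩
  · rintro ⟨a, ha, b, hb, rfl⟩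
    exact Or.inr ⟨a, b, rfl, ha, hb⟩

/-- A language is regular if membership depends only on the value of the word under a
homomorphism to a finite monoid. -/
theorem IsRegular.of_monoid {M : Type*} [Monoid M] [Finite M] (f : α → M) (S : Set M) :
    IsRegular ({w | (w.map f).prod ∈ S} : Language α) := by
  let A : DFA α M := ⟨fun s a => s * f a, 1, S⟩
  have key : ∀ (w : List α) (s : M), A.evalFrom s w = s * (w.map f).prod := by
    intro w
    induction w with
    | nil => simp
    | cons a w ih =>
      intro s
      rw [DFA.evalFrom_cons, ih]
      simp [A, mul_assoc]
  refine isRegular_iff.2 ⟨M, Fintype.ofFinite _, A, ?_⟩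
  ext w
  change A.evalFrom 1 w ∈ S ↔ (w.map f).prod ∈ S
  rw [key, one_mul]

theorem IsRegular.forall_mem (p : α → Prop) :
    IsRegular ({w | ∀ a ∈ w, p a} : Language α) := by
  classical
  let A : DFA α Bool := ⟨fun s a => s && decide (p a), true, {true}⟩
  have key : ∀ (w : List α) (s : Bool), A.evalFrom s w = true ↔ s = true ∧ ∀ a ∈ w, p a := by
    intro w
    induction w with
    | nil => simp
    | cons a w ih =>
      intro s
      rw [DFA.evalFrom_cons, ih]
      simp [A, and_assoc]
  refine ⟨Bool, inferInstance, A, ?_⟩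
  ext w
  exact (key w true).trans (by simp; rfl)

theorem IsRegular.countP_eq (p : α → Bool) (c : ℕ) :
    IsRegular ({w | w.countP p = c} : Language α) := by
  let A : DFA α (Fin (c + 2)) :=
    ⟨fun s a => if p a then ⟨min (s + 1) (c + 1), by omega⟩ else s, 0, {⟨c, by omega⟩}⟩
  have key : ∀ (w : List α) (s : Fin (c + 2)),
      (A.evalFrom s w : ℕ) = min (s + w.countP p) (c + 1) := by
    intro w
    induction w with
    | nil => intro s; simp; omega
    | cons a w ih =>
      intro s
      rw [DFA.evalFrom_cons, ih]
      by_cases h : p a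
      · simp [A, h]; omega
      · simp [A, h]
  refine ⟨Fin (c + 2), inferInstance, A, ?_⟩
  ext w
  change A.evalFrom 0 w = ⟨c, _⟩ ↔ w.countP p = c
  rw [Fin.ext_iff, key]
  simp only [Fin.coe_ofNat_eq_mod, Nat.zero_mod]
  omega

theorem IsRegular.preimage_map {β : Type*} {L : Language β} (h : L.IsRegular) (f : α → β) :
    IsRegular ({w | w.map f ∈ L} : Language α) := by
  obtain ⟨σ, _, M, rfl⟩ := h
  exact ⟨σ, inferInstance, M.comap f, by rw [DFA.accepts_comap]; rfl⟩

theorem IsRegular.top : IsRegular ({_w | True} : Language α) := by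
  simpa using IsRegular.forall_mem (fun _ : α => True)

theorem IsRegular.exists {ι : Type*} [Finite ι] {L : ι → Language α}
    (h : ∀ i, (L i).IsRegular) : IsRegular ({w | ∃ i, w ∈ L i} : Language α) := by
  classical
  have := Fintype.ofFinite ι
  have key : ∀ s : Finset ι, IsRegular ({w | ∃ i ∈ s, w ∈ L i} : Language α) := by
    intro s
    induction s using Finset.induction_on with
    | empty =>
      refine (IsRegular.top (α := α)).compl.congr fun w => ?_
      change (∃ i ∈ ∅, w ∈ L i) ↔ ¬ True
      simp
    | insert a s ha ih =>
      refine ((h a).add ih).congr fun w => ?_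
      change (∃ i ∈ insert a s, w ∈ L i) ↔ w ∈ L a ∨ (∃ i ∈ s, w ∈ L i)
      simp
  refine (key Finset.univ).congr fun w => ?_
  change (∃ i, w ∈ L i) ↔ ∃ i ∈ Finset.univ, w ∈ L i
  simp

theorem IsRegular.singleton_letter (a : α) : IsRegular ({[a]} : Language α) := by
  classical
  convert (IsRegular.forall_mem (fun b : α => b = a)).inf
    (IsRegular.countP_eq (fun _ : α => true) 1) using 2
  ext w
  change w = [a] ↔ (∀ b ∈ w, b = a) ∧ w.countP (fun _ => true) = 1
  rw [List.countP_true, List.length_eq_one_iff]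
  constructor
  · rintro rfl
    simp
  · rintro ⟨h, b, rfl⟩
    simpa using h

/-- The cyclic permutations of the words of a regular language form a regular language: a cyclic
permutation `u ++ v` of `v ++ u` is guessed together with the state reached after `v`. -/
theorem IsRegular.cyclicShift {L : Language α} (h : L.IsRegular) :
    IsRegular ({w | ∃ u v, w = u ++ v ∧ v ++ u ∈ L} : Language α) := by
  obtain ⟨σ, _, M, rfl⟩ := h
  have h₁ : ∀ q : σ, (M.acceptsFrom q).IsRegular := fun q =>
    ⟨σ, inferInstance, ⟨M.step, q, M.accept⟩, rfl⟩
  have h₂ : ∀ q : σ, IsRegular ({w | M.eval w = q} : Language α) := fun q =>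
    ⟨σ, inferInstance, ⟨M.step, M.start, {q}⟩, rfl⟩
  refine (IsRegular.exists fun q => (h₁ q).mul (h₂ q)).congr fun w => ?_
  change (∃ u v, w = u ++ v ∧ v ++ u ∈ M.accepts) ↔ ∃ q, w ∈ M.acceptsFrom q * _
  constructor
  · rintro ⟨u, v, rfl, h⟩
    refine ⟨M.eval v, Language.mem_mul.mpr ⟨u, ?_, v, rfl, rfl⟩⟩
    rwa [DFA.mem_accepts, DFA.eval, DFA.evalFrom_of_append] at h
  · rintro ⟨q, h⟩
    obtain ⟨u, hu, v, rfl, rfl⟩ := Language.mem_mul.mp h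
    refine ⟨u, v, rfl, ?_⟩
    rwa [DFA.mem_accepts, DFA.eval, DFA.evalFrom_of_append]

end Language

/-! ### Piles: reduced words of a right-angled Artin group are geodesic -/

section Piles

variable {V : Type*}

/-- The element of `A_Γ` given by a word in the letters `v ^ e`, `e = ± 1`. -/
def raagEval (Γ : SimpleGraph V) (w : List (V × ℤˣ)) : RAAG Γ :=
  (w.map fun x => RAAG.gen Γ x.1 ^ (x.2 : ℤ)).prod

@[simp]
theorem raagEval_nil (Γ : SimpleGraph V) : raagEval Γ [] = 1 := rfl

@[simp]
theorem raagEval_cons (Γ : SimpleGraph V) (x : V × ℤˣ) (w : List (V × ℤˣ)) :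
    raagEval Γ (x :: w) = RAAG.gen Γ x.1 ^ (x.2 : ℤ) * raagEval Γ w := rfl

@[simp]
theorem raagEval_append (Γ : SimpleGraph V) (w w' : List (V × ℤˣ)) :
    raagEval Γ (w ++ w') = raagEval Γ w * raagEval Γ w' := by
  simp [raagEval]

/-- A word is reduced if no two inverse letters `x`, `x⁻¹` in it are separated only by letters
whose vertices are adjacent to the vertex of `x`. -/
def IsReducedWord (Γ : SimpleGraph V) (w : List (V × ℤˣ)) : Prop :=
  ∀ p x q r, (∀ y ∈ q, Γ.Adj x.1 y.1) → w ≠ p ++ x :: q ++ (x.1, -x.2) :: r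

theorem IsReducedWord.of_append_right {Γ : SimpleGraph V} {w w' : List (V × ℤˣ)}
    (h : IsReducedWord Γ (w ++ w')) : IsReducedWord Γ w' := by
  intro p x q r hq hw
  exact h (w ++ p) x q r hq (by simp [hw])

/-- A pile has one stack for each vertex. The letter `v ^ e` puts the token `some e` on the
stack of `v` and the token `none` on the stack of each other vertex not adjacent to `v`. -/
abbrev Pile (V : Type*) := V → List (Option ℤˣ)

open Classical in
/-- Put the tokens of the letter `x` on the stacks. -/
noncomputable def Pile.push (Γ : SimpleGraph V) (x : V × ℤˣ) (p : Pile V) : Pile V := fun z =>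
  if Γ.Adj x.1 z then p z else (if z = x.1 then some x.2 else none) :: p z

open Classical in
/-- Remove the top token from the stack of each vertex that is not adjacent to `v`. -/
noncomputable def Pile.pop (Γ : SimpleGraph V) (v : V) (p : Pile V) : Pile V := fun z =>
  if Γ.Adj v z then p z else (p z).tail

/-- The piles obtained from the empty pile by pushing letters that do not cancel. -/
inductive Pile.Reach (Γ : SimpleGraph V) : Pile V → Prop
  | empty : Reach Γ fun _ => []
  | push {p : Pile V} (x : V × ℤˣ) (hp : Reach Γ p)
      (hx : (p x.1).head? ≠ some (some (-x.2))) : Reach Γ (Pile.push Γ x p)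

open Classical in
/-- A letter acts on a pile by removing its inverse if that is on top, and by being pushed
otherwise. -/
noncomputable def Pile.act (Γ : SimpleGraph V) (x : V × ℤˣ) (p : Pile V) : Pile V :=
  if (p x.1).head? = some (some (-x.2)) then Pile.pop Γ x.1 p else Pile.push Γ x p

namespace Pile

variable {Γ : SimpleGraph V}

theorem pop_push (x : V × ℤˣ) (p : Pile V) : pop Γ x.1 (push Γ x p) = p := by
  funext z
  by_cases h : Γ.Adj x.1 z <;> simp [pop, push, h]

theorem push_self (x : V × ℤˣ) (p : Pile V) : push Γ x p x.1 = some x.2 :: p x.1 := by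
  simp [push]

theorem push_of_adj {x : V × ℤˣ} {z : V} (h : Γ.Adj x.1 z) (p : Pile V) :
    push Γ x p z = p z := by
  simp [push, h]

theorem pop_of_adj {v z : V} (h : Γ.Adj v z) (p : Pile V) : pop Γ v p z = p z := by
  simp [pop, h]

theorem push_comm {x y : V × ℤˣ} (h : Γ.Adj x.1 y.1) (p : Pile V) :
    push Γ x (push Γ y p) = push Γ y (push Γ x p) := by
  funext z
  by_cases hx : Γ.Adj x.1 z <;> by_cases hy : Γ.Adj y.1 z <;> simp [push, hx, hy]
  have h₁ : z ≠ x.1 := by rintro rfl; exact hy h.symm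
  have h₂ : z ≠ y.1 := by rintro rfl; exact hx h
  simp [h₁, h₂]

theorem pop_comm (v w : V) (p : Pile V) : pop Γ v (pop Γ w p) = pop Γ w (pop Γ v p) := by
  funext z
  by_cases hx : Γ.Adj v z <;> by_cases hy : Γ.Adj w z <;> simp [pop, hx, hy]

/-- A letter on top of its stack in a reachable pile may be taken to be the last one pushed. -/
theorem Reach.push_pop {p : Pile V} (hp : Reach Γ p) (x : V × ℤˣ)
    (hx : (p x.1).head? = some (some x.2)) :
    Reach Γ (pop Γ x.1 p) ∧ Pile.push Γ x (pop Γ x.1 p) = p ∧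
      (pop Γ x.1 p x.1).head? ≠ some (some (-x.2)) := by
  induction hp with
  | empty => simp at hx
  | @push q y hq hy ih =>
    by_cases hv : y.1 = x.1
    · have hyx : y = x := by
        rw [← hv, push_self] at hx
        exact Prod.ext hv (by simpa using hx)
      subst hyx
      rw [pop_push]
      exact ⟨hq, rfl, hy⟩
    · have hadj : Γ.Adj y.1 x.1 := by
        by_contra h
        simp [Pile.push, h, Ne.symm hv] at hx
      rw [push_of_adj hadj] at hx
      obtain ⟨h₁, h₂, h₃⟩ := ih hx
      have hpop : pop Γ x.1 (Pile.push Γ y q) = Pile.push Γ y (pop Γ x.1 q) := by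
        conv_lhs => rw [← h₂]
        rw [push_comm hadj, pop_push]
      rw [hpop]
      refine ⟨.push y h₁ ?_, ?_, ?_⟩
      · rwa [pop_of_adj hadj.symm]
      · rw [push_comm hadj.symm, h₂]
      · rwa [push_of_adj hadj]

theorem act_of_head {x : V × ℤˣ} {p : Pile V} (h : (p x.1).head? = some (some (-x.2))) :
    act Γ x p = pop Γ x.1 p := by
  simp [act, h]

theorem act_of_not_head {x : V × ℤˣ} {p : Pile V} (h : (p x.1).head? ≠ some (some (-x.2))) :
    act Γ x p = push Γ x p := by
  simp [act, h]

theorem Reach.act {p : Pile V} (hp : Reach Γ p) (x : V × ℤˣ) : Reach Γ (act Γ x p) := by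
  by_cases h : (p x.1).head? = some (some (-x.2))
  · rw [act_of_head h]
    exact (hp.push_pop (x.1, -x.2) h).1
  · rw [act_of_not_head h]
    exact .push x hp h

theorem Reach.act_inv_act {p : Pile V} (hp : Reach Γ p) (x : V × ℤˣ) :
    Pile.act Γ (x.1, -x.2) (Pile.act Γ x p) = p := by
  by_cases h : (p x.1).head? = some (some (-x.2))
  · obtain ⟨_, h₂, h₃⟩ := hp.push_pop (x.1, -x.2) h
    rw [act_of_head h, act_of_not_head h₃]
    exact h₂
  · rw [act_of_not_head h, act_of_head (by simp [push_self])]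
    exact pop_push x p

theorem Reach.pop_push_comm {p : Pile V} (hp : Reach Γ p) {x y : V × ℤˣ} (h : Γ.Adj x.1 y.1)
    (hx : (p x.1).head? = some (some (-x.2))) :
    pop Γ x.1 (Pile.push Γ y p) = Pile.push Γ y (pop Γ x.1 p) := by
  obtain ⟨_, h₂, _⟩ := hp.push_pop (x.1, -x.2) hx
  conv_lhs => rw [← h₂]
  rw [push_comm (x := y) (y := (x.1, -x.2)) h.symm]
  exact pop_push (x.1, -x.2) _

theorem Reach.act_comm {p : Pile V} (hp : Reach Γ p) {x y : V × ℤˣ} (h : Γ.Adj x.1 y.1) :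
    Pile.act Γ x (Pile.act Γ y p) = Pile.act Γ y (Pile.act Γ x p) := by
  by_cases hx : (p x.1).head? = some (some (-x.2)) <;>
    by_cases hy : (p y.1).head? = some (some (-y.2))
  · rw [act_of_head hx, act_of_head hy, act_of_head (by rwa [pop_of_adj h.symm]),
      act_of_head (by rwa [pop_of_adj h]), pop_comm]
  · rw [act_of_head hx, act_of_not_head hy, act_of_head (by rwa [push_of_adj h.symm]),
      act_of_not_head (by rwa [pop_of_adj h]), hp.pop_push_comm h hx]
  · rw [act_of_not_head hx, act_of_head hy, act_of_not_head (by rwa [pop_of_adj h.symm]),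
      act_of_head (by rwa [push_of_adj h]), hp.pop_push_comm h.symm hy]
  · rw [act_of_not_head hx, act_of_not_head hy, act_of_not_head (by rwa [push_of_adj h.symm]),
      act_of_not_head (by rwa [push_of_adj h]), push_comm h]

/-- The permutation of the reachable piles given by a letter. -/
noncomputable def actPerm (Γ : SimpleGraph V) (x : V × ℤˣ) :
    Equiv.Perm {p : Pile V // Reach Γ p} where
  toFun p := ⟨act Γ x p, p.2.act x⟩
  invFun p := ⟨act Γ (x.1, -x.2) p, p.2.act _⟩
  left_inv p := Subtype.ext (p.2.act_inv_act x)
  right_inv p := Subtype.ext (by simpa using p.2.act_inv_act (x.1, -x.2))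

theorem actPerm_neg (x : V × ℤˣ) : actPerm Γ (x.1, -x.2) = (actPerm Γ x)⁻¹ := by
  rw [eq_inv_iff_mul_eq_one]
  ext p : 2
  exact p.2.act_inv_act x

/-- The action of `A_Γ` on the reachable piles. -/
noncomputable def raagAct (Γ : SimpleGraph V) : RAAG Γ →* Equiv.Perm {p : Pile V // Reach Γ p} :=
  PresentedGroup.toGroup (f := fun v => actPerm Γ (v, 1)) (by
    rintro _ ⟨u, v, h, rfl⟩
    rw [map_mul, map_mul, map_mul, map_inv, map_inv, FreeGroup.lift_apply_of,
      FreeGroup.lift_apply_of, mul_inv_eq_one, mul_inv_eq_iff_eq_mul]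
    ext p : 2
    exact p.2.act_comm (x := (u, 1)) (y := (v, 1)) h)

theorem raagAct_gen (x : V × ℤˣ) :
    raagAct Γ (RAAG.gen Γ x.1 ^ (x.2 : ℤ)) = actPerm Γ x := by
  have h : raagAct Γ (RAAG.gen Γ x.1) = actPerm Γ (x.1, 1) := PresentedGroup.toGroup.of _
  obtain ⟨v, e⟩ := x
  obtain rfl | rfl := Int.units_eq_one_or e
  · simpa using h
  · simpa [h] using (actPerm_neg (Γ := Γ) (v, 1)).symm

theorem raagAct_eval (w : List (V × ℤˣ)) :
    (raagAct Γ (raagEval Γ w) ⟨_, .empty⟩).1 = w.foldr (act Γ) fun _ => [] := by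
  induction w with
  | nil => simp
  | cons x w ih =>
    rw [raagEval_cons, map_mul, raagAct_gen, List.foldr_cons, ← ih]
    rfl

/-- The number of letters in a pile: the number of its tokens of the form `some e`. -/
def size [Fintype V] (p : Pile V) : ℕ := ∑ v, (p v).countP Option.isSome

theorem size_push [Fintype V] (x : V × ℤˣ) (p : Pile V) : size (push Γ x p) = size p + 1 := by
  classical
  have : ∀ z, (push Γ x p z).countP Option.isSome =
      (p z).countP Option.isSome + if z = x.1 then 1 else 0 := by
    intro z
    by_cases hz : z = x.1
    · subst hz
      simp [push]
    · by_cases h : Γ.Adj x.1 z <;> simp [push, h, hz]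
  simp [size, this, Finset.sum_add_distrib]

theorem size_act_le [Fintype V] (x : V × ℤˣ) (p : Pile V) : size (act Γ x p) ≤ size p + 1 := by
  by_cases h : (p x.1).head? = some (some (-x.2))
  · rw [act_of_head h]
    refine (Finset.sum_le_sum fun z _ => ?_).trans (Nat.le_succ _)
    by_cases hz : Γ.Adj x.1 z
    · rw [pop_of_adj hz]
    · simpa [pop, hz] using (List.tail_sublist (p z)).countP_le
  · rw [act_of_not_head h, size_push]

theorem exists_split_of_head_foldr_push (w : List (V × ℤˣ)) (x : V × ℤˣ)
    (h : ((w.foldr (push Γ) fun _ => []) x.1).head? = some (some x.2)) :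
    ∃ q r, (∀ y ∈ q, Γ.Adj x.1 y.1) ∧ w = q ++ x :: r := by
  induction w with
  | nil => simp at h
  | cons y w ih =>
    by_cases hv : x.1 = y.1
    · refine ⟨[], w, by simp, ?_⟩
      rw [List.foldr_cons, hv, push_self] at h
      simp [Prod.ext_iff, hv, show y.2 = x.2 by simpa using h]
    · have hadj : Γ.Adj y.1 x.1 := by
        by_contra hn
        simp [push, hn, hv] at h
      rw [List.foldr_cons, push_of_adj hadj] at h
      obtain ⟨q, r, hq, rfl⟩ := ih h
      exact ⟨y :: q, r, by simpa [hadj.symm] using hq, rfl⟩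

theorem foldr_act_of_isReducedWord {w : List (V × ℤˣ)} (h : IsReducedWord Γ w) :
    w.foldr (act Γ) (fun _ => []) = w.foldr (push Γ) fun _ => [] := by
  induction w with
  | nil => rfl
  | cons x w ih =>
    rw [List.foldr_cons, List.foldr_cons, ih (h.of_append_right (w := [x])), act_of_not_head]
    intro hx
    obtain ⟨q, r, hq, rfl⟩ := exists_split_of_head_foldr_push w (x.1, -x.2) hx
    exact h [] x q r hq rfl

end Pile

/-- Reduced words are geodesic: every letter of a reduced word puts one letter on the empty pile,
and a word of length `n` cannot put more than `n` letters there. -/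
theorem IsReducedWord.length_le [Finite V] {Γ : SimpleGraph V} {w u : List (V × ℤˣ)}
    (h : IsReducedWord Γ w) (hu : raagEval Γ u = raagEval Γ w) : w.length ≤ u.length := by
  have := Fintype.ofFinite V
  have h₁ : ∀ w : List (V × ℤˣ),
      Pile.size (w.foldr (Pile.push Γ) fun _ => []) = w.length := by
    intro w
    induction w with
    | nil => simp [Pile.size]
    | cons x w ih => simp [Pile.size_push, ih]
  have h₂ : ∀ w : List (V × ℤˣ),
      Pile.size (w.foldr (Pile.act Γ) fun _ => []) ≤ w.length := by
    intro w
    induction w with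
    | nil => simp [Pile.size]
    | cons x w ih => exact (Pile.size_act_le x _).trans (by simpa using ih)
  rw [← h₁ w, ← Pile.foldr_act_of_isReducedWord h, ← Pile.raagAct_eval, ← hu,
    Pile.raagAct_eval]
  exact h₂ u

end Piles

/-! ### Words of minimal length in a twisted conjugacy class -/

section TwistedConjugacy

variable {V : Type*} {Γ : SimpleGraph V}

/-- The action on letters of the automorphism `v ↦ v ^ δ v`. -/
def twist (δ : V → ℤˣ) (x : V × ℤˣ) : V × ℤˣ := (x.1, δ x.1 * x.2)

theorem twist_twist (δ : V → ℤˣ) (x : V × ℤˣ) : twist δ (twist δ x) = x := by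
  simp [twist, ← mul_assoc]

theorem map_twist_twist (δ : V → ℤˣ) (w : List (V × ℤˣ)) :
    (w.map (twist δ)).map (twist δ) = w := by
  simp [Function.comp_def, twist_twist]

theorem eq_map_twist_of_map_twist_eq {δ : V → ℤˣ} {w w' : List (V × ℤˣ)}
    (h : w.map (twist δ) = w') : w = w'.map (twist δ) := by
  rw [← h, map_twist_twist]

theorem RAAG.commute_gen {u v : V} (h : Γ.Adj u v) : Commute (RAAG.gen Γ u) (RAAG.gen Γ v) := by
  have := PresentedGroup.one_of_mem (rels := raagRels Γ) ⟨u, v, h, rfl⟩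
  rw [map_mul, map_mul, map_mul, map_inv, map_inv, mul_inv_eq_one, mul_inv_eq_iff_eq_mul] at this
  exact this

theorem forall_mem_map_twist_adj {δ : V → ℤˣ} {v : V} {w : List (V × ℤˣ)} :
    (∀ z ∈ w.map (twist δ), Γ.Adj v z.1) ↔ ∀ z ∈ w, Γ.Adj v z.1 :=
  List.forall_mem_map

theorem map_raagEval {δ : V → ℤˣ} {ψ : RAAG Γ →* RAAG Γ}
    (hψ : ∀ v, ψ (RAAG.gen Γ v) = RAAG.gen Γ v ^ (δ v : ℤ)) (w : List (V × ℤˣ)) :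
    ψ (raagEval Γ w) = raagEval Γ (w.map (twist δ)) := by
  induction w with
  | nil => simp
  | cons x w ih => simp [ih, hψ, twist, zpow_mul]

theorem raagEval_surjective (Γ : SimpleGraph V) : Function.Surjective (raagEval Γ) := by
  intro g
  have hinv : ∀ w, ∃ w', raagEval Γ w' = (raagEval Γ w)⁻¹ := by
    intro w
    induction w with
    | nil => exact ⟨[], by simp⟩
    | cons x w ih =>
      obtain ⟨w', hw'⟩ := ih
      exact ⟨w' ++ [(x.1, -x.2)], by simp [hw']⟩
  have hg : g ∈ Subgroup.closure (Set.range (PresentedGroup.of (rels := raagRels Γ))) := by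
    rw [PresentedGroup.closure_range_of]
    trivial
  induction hg using Subgroup.closure_induction with
  | mem g hg =>
    obtain ⟨v, rfl⟩ := hg
    exact ⟨[(v, 1)], by simp [RAAG.gen]⟩
  | one => exact ⟨[], rfl⟩
  | mul a b _ _ ha hb =>
    obtain ⟨w, rfl⟩ := ha
    obtain ⟨w', rfl⟩ := hb
    exact ⟨w ++ w', by simp⟩
  | inv a _ ha =>
    obtain ⟨w, rfl⟩ := ha
    exact hinv w

theorem IsReducedWord.map_twist {w : List (V × ℤˣ)} (h : IsReducedWord Γ w) (δ : V → ℤˣ) :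
    IsReducedWord Γ (w.map (twist δ)) := by
  intro p x q r hq hw
  refine h (p.map (twist δ)) (twist δ x) (q.map (twist δ)) (r.map (twist δ)) ?_ ?_
  · exact forall_mem_map_twist_adj.mpr hq
  · rw [eq_map_twist_of_map_twist_eq hw]
    simp [twist]

theorem IsReducedWord.append {w u : List (V × ℤˣ)} (hw : IsReducedWord Γ w)
    (hu : IsReducedWord Γ u)
    (h : ∀ p x q₁ q₂ r, (∀ y ∈ q₁, Γ.Adj x.1 y.1) → (∀ y ∈ q₂, Γ.Adj x.1 y.1) →
      w = p ++ x :: q₁ → u ≠ q₂ ++ (x.1, -x.2) :: r) : IsReducedWord Γ (w ++ u) := by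
  intro p x q r hq e
  rw [List.append_assoc, List.cons_append, List.append_eq_append_iff] at e
  rcases e with ⟨a, rfl, e⟩ | ⟨a, rfl, e⟩
  · exact hu a x q r hq (by simpa using e)
  · rcases a with _ | ⟨y, a⟩
    · exact hu [] x q r hq (by simpa using e.symm)
    · obtain ⟨rfl, e'⟩ := List.cons_eq_cons.mp (e.trans (List.cons_append ..))
      rcases List.append_eq_append_iff.mp e' with ⟨b, rfl, e₂⟩ | ⟨b, rfl, e₂⟩
      · rcases b with _ | ⟨z, b⟩
        · exact h p x q [] r hq (by simp) (by simp) (by simpa using e₂.symm)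
        · obtain ⟨rfl, -⟩ := List.cons_eq_cons.mp (e₂.trans (List.cons_append ..))
          exact hw p x q b hq (by simp)
      · simp only [List.mem_append] at hq
        exact h p x a b r (fun y hy => hq y (.inl hy)) (fun y hy => hq y (.inr hy)) rfl e₂

/-- A word is twisted cyclically reduced if it is not, up to commutations, of the form
`y s (ψ y)⁻¹` for a letter `y`, where `ψ` is the twist `v ↦ v ^ δ v`. Otherwise it could be
shortened to `s` by twisted conjugation. The letters `y` and `(ψ y)⁻¹` have to be two different
occurrences in the word. -/
def IsTwistedCyclicallyReduced (Γ : SimpleGraph V) (δ : V → ℤˣ) (w : List (V × ℤˣ)) : Prop :=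
  ∀ p y s r, (∀ z ∈ p, Γ.Adj y.1 z.1) → (∀ z ∈ r, Γ.Adj y.1 z.1) →
    w ≠ p ++ y :: s ++ (y.1, -(δ y.1 * y.2)) :: r

/-- A vertex is exceptional for a word if it is inverted by the twist and occurs exactly once in
the word, where it commutes with all the other letters. -/
def IsExceptional (Γ : SimpleGraph V) (δ : V → ℤˣ) (w : List (V × ℤˣ)) (v : V) : Prop :=
  δ v = -1 ∧ ∃ p e q, (∀ z ∈ p, Γ.Adj v z.1) ∧ (∀ z ∈ q, Γ.Adj v z.1) ∧ w = p ++ (v, e) :: q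

/-- The word `w (ψ w) w (ψ w) ⋯` with `n` factors, where `ψ` is the twist. -/
def alternating (δ : V → ℤˣ) (w : List (V × ℤˣ)) : ℕ → List (V × ℤˣ)
  | 0 => []
  | n + 1 => w ++ (alternating δ w n).map (twist δ)

theorem length_alternating (δ : V → ℤˣ) (w : List (V × ℤˣ)) (n : ℕ) :
    (alternating δ w n).length = n * w.length := by
  induction n with
  | zero => simp [alternating]
  | succ n ih => simp [alternating, ih]; ring

theorem raagEval_alternating (δ : V → ℤˣ) (w : List (V × ℤˣ)) (n : ℕ) :
    raagEval Γ (alternating δ w (2 * n)) =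
      (raagEval Γ w * raagEval Γ (w.map (twist δ))) ^ n := by
  induction n with
  | zero => simp [alternating]
  | succ n ih =>
    rw [pow_succ', ← ih, mul_add, mul_one]
    simp only [alternating, List.map_append, raagEval_append, map_twist_twist, mul_assoc]

/-- Letters of different factors of `w (ψ w) w (ψ w) ⋯` cancel only if the last occurrence of
a vertex in one factor cancels with its first occurrence in the next one. These are two
occurrences in `w` that contradict twisted cyclic reducedness, or one exceptional occurrence. -/
theorem isReducedWord_alternating {δ : V → ℤˣ} {w : List (V × ℤˣ)} (hw : IsReducedWord Γ w)
    (hc : IsTwistedCyclicallyReduced Γ δ w) (he : ∀ v, ¬ IsExceptional Γ δ w v) (n : ℕ) :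
    IsReducedWord Γ (alternating δ w n) := by
  induction n with
  | zero => intro p x q r _ h; simp [alternating] at h
  | succ n ih =>
    refine hw.append (ih.map_twist δ) ?_
    intro p x q₁ q₂ r h₁ h₂ hwx hu
    cases n with
    | zero => simp [alternating] at hu
    | succ n =>
      have hx : x ∈ w := by simp [hwx]
      -- A whole factor cannot consist of letters adjacent to `x`, as it contains `x` up to sign.
      have habs : ∀ a, q₂ ≠ w.map (twist δ) ++ a := by
        rintro a rfl
        exact (h₂ (twist δ x) (by simp; exact Or.inl ⟨_, _, hx, rfl⟩)).ne rfl
      rw [alternating, List.map_append, map_twist_twist, List.append_eq_append_iff] at hu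
      rcases hu with ⟨a, hq, -⟩ | ⟨a, hwa, hu⟩
      · exact habs a hq
      rcases a with _ | ⟨y, c⟩
      · exact habs [] (by simpa using hwa.symm)
      obtain ⟨rfl, -⟩ := List.cons_eq_cons.mp (hu.trans (List.cons_append ..))
      have hw₂ := eq_map_twist_of_map_twist_eq hwa
      rw [List.map_append, List.map_cons] at hw₂
      have h₂' : ∀ z ∈ q₂.map (twist δ), Γ.Adj x.1 z.1 := forall_mem_map_twist_adj.mpr h₂
      generalize q₂.map (twist δ) = q' at hw₂ h₂'
      -- The case of a single occurrence.
      have hsame : p = q' → x = twist δ (x.1, -x.2) → False := by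
        rintro rfl h
        refine he x.1 ⟨?_, p, x.2, q₁, h₂', h₁, hwx⟩
        have h := congrArg Prod.snd h
        simp only [twist, mul_neg] at h
        obtain hd | hd := Int.units_eq_one_or (δ x.1)
        · rw [hd, one_mul] at h
          exact absurd h (units_ne_neg_self x.2)
        · exact hd
      have hw₃ := hw₂
      rw [hwx, List.append_eq_append_iff] at hw₃
      rcases hw₃ with ⟨a, rfl, e⟩ | ⟨a, rfl, e⟩
      · rcases a with _ | ⟨z, a⟩
        · exact hsame (by simp) (List.cons_eq_cons.mp e).1
        · obtain ⟨rfl, -⟩ := List.cons_eq_cons.mp (e.trans (List.cons_append ..))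
          exact (h₂' x (by simp)).ne rfl
      · rcases a with _ | ⟨z, a⟩
        · exact hsame (by simp) (List.cons_eq_cons.mp e).1.symm
        · obtain ⟨rfl, -⟩ := List.cons_eq_cons.mp (e.trans (List.cons_append ..))
          refine hc q' (twist δ (x.1, -x.2)) a q₁ h₂' h₁ ?_
          rw [hwx]
          simp [twist, ← mul_assoc]

/-- The growth argument: if `h = b a (ψ b)⁻¹` then `(h ψ(h)) ^ N` is conjugate to
`(a ψ(a)) ^ N` by `b`. The latter has length `2 N |w|`, so `2 N |w| ≤ 2 N |u| + 2 |b|` for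
all `N`. -/
theorem length_le_of_twistedConj_of_not_isExceptional [Finite V] {δ : V → ℤˣ}
    {ψ : RAAG Γ →* RAAG Γ} (hψ : ∀ v, ψ (RAAG.gen Γ v) = RAAG.gen Γ v ^ (δ v : ℤ))
    {w u : List (V × ℤˣ)} (hw : IsReducedWord Γ w) (hc : IsTwistedCyclicallyReduced Γ δ w)
    (he : ∀ v, ¬ IsExceptional Γ δ w v) (b : RAAG Γ)
    (hu : raagEval Γ u = b * raagEval Γ w * (ψ b)⁻¹) : w.length ≤ u.length := by
  obtain ⟨B, hB⟩ := raagEval_surjective Γ b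
  obtain ⟨B', hB'⟩ := raagEval_surjective Γ b⁻¹
  have hψψ : ψ (ψ b) = b := by
    rw [← hB, map_raagEval hψ, map_raagEval hψ, map_twist_twist]
  have hconj : raagEval Γ w * raagEval Γ (w.map (twist δ)) =
      b⁻¹ * (raagEval Γ u * raagEval Γ (u.map (twist δ))) * b := by
    rw [← map_raagEval hψ, ← map_raagEval hψ, hu]
    simp only [map_mul, map_inv, hψψ]
    group
  have hpow : ∀ n : ℕ, (raagEval Γ w * raagEval Γ (w.map (twist δ))) ^ n =
      b⁻¹ * (raagEval Γ u * raagEval Γ (u.map (twist δ))) ^ n * b := by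
    intro n
    rw [hconj]
    simpa using conj_pow (i := n) (a := b⁻¹) (b := raagEval Γ u * raagEval Γ (u.map (twist δ)))
  have hlen : ∀ n : ℕ, 2 * n * w.length ≤ B'.length + 2 * n * u.length + B.length := by
    intro n
    have := (isReducedWord_alternating hw hc he (2 * n)).length_le
      (u := B' ++ alternating δ u (2 * n) ++ B) (by
        simp only [raagEval_append, raagEval_alternating, hB, hB', hpow])
    simpa [length_alternating, add_assoc] using this
  by_contra! hlt
  have h := hlen (B.length + B'.length + 1)
  nlinarith

/-- The retraction of `A_Γ` that kills the vertices in `E`. -/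
noncomputable def killVertices (Γ : SimpleGraph V) (E : Set V) [DecidablePred (· ∈ E)] :
    RAAG Γ →* RAAG Γ :=
  PresentedGroup.toGroup (f := fun v => if v ∈ E then 1 else RAAG.gen Γ v) (by
    rintro _ ⟨u, v, h, rfl⟩
    by_cases hu : u ∈ E <;> by_cases hv : v ∈ E <;>
      simp [hu, hv, (RAAG.commute_gen h).eq])

theorem killVertices_gen (E : Set V) [DecidablePred (· ∈ E)] (v : V) :
    killVertices Γ E (RAAG.gen Γ v) = if v ∈ E then 1 else RAAG.gen Γ v :=
  PresentedGroup.toGroup.of _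

theorem killVertices_raagEval (E : Set V) [DecidablePred (· ∈ E)] (w : List (V × ℤˣ)) :
    killVertices Γ E (raagEval Γ w) = raagEval Γ (w.filter fun x => x.1 ∉ E) := by
  induction w with
  | nil => simp
  | cons x w ih =>
    by_cases h : x.1 ∈ E <;> simp [ih, killVertices_gen, h]

/-- The parity of the exponent sum of the vertex `v`, with values in `{1, -1}`. -/
noncomputable def vertexParity (Γ : SimpleGraph V) [DecidableEq V] (v : V) : RAAG Γ →* ℤˣ :=
  PresentedGroup.toGroup (f := fun z => if z = v then -1 else 1) (by
    rintro _ ⟨a, b, -, rfl⟩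
    rw [map_mul, map_mul, map_mul, map_inv, map_inv, mul_inv_eq_one, mul_inv_eq_iff_eq_mul,
      mul_comm])

theorem vertexParity_gen [DecidableEq V] (v z : V) :
    vertexParity Γ v (RAAG.gen Γ z) = if z = v then -1 else 1 :=
  PresentedGroup.toGroup.of _

theorem vertexParity_gen_zpow [DecidableEq V] (v z : V) (e : ℤˣ) :
    vertexParity Γ v (RAAG.gen Γ z ^ (e : ℤ)) = if z = v then -1 else 1 := by
  obtain rfl | rfl := Int.units_eq_one_or e <;> by_cases h : z = v <;>
    simp [vertexParity_gen, h]

theorem vertexParity_raagEval_of_forall_ne [DecidableEq V] (v : V) (w : List (V × ℤˣ))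
    (h : ∀ x ∈ w, x.1 ≠ v) : vertexParity Γ v (raagEval Γ w) = 1 := by
  induction w with
  | nil => simp
  | cons x w ih =>
    simp only [List.mem_cons, forall_eq_or_imp] at h
    simp [ih h.2, vertexParity_gen_zpow, h.1, -map_zpow]

theorem vertexParity_map [DecidableEq V] {δ : V → ℤˣ} {ψ : RAAG Γ →* RAAG Γ}
    (hψ : ∀ v, ψ (RAAG.gen Γ v) = RAAG.gen Γ v ^ (δ v : ℤ)) (v : V) (g : RAAG Γ) :
    vertexParity Γ v (ψ g) = vertexParity Γ v g := by
  have : (vertexParity Γ v).comp ψ = vertexParity Γ v := by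
    refine PresentedGroup.ext fun z => ?_
    change vertexParity Γ v (ψ (RAAG.gen Γ z)) = vertexParity Γ v (RAAG.gen Γ z)
    rw [hψ, vertexParity_gen_zpow, vertexParity_gen]
  exact DFunLike.congr_fun this g

/-- An exceptional vertex has odd exponent sum, and twisted conjugation preserves the parity. -/
theorem IsExceptional.mem_of_twistedConj {δ : V → ℤˣ} {ψ : RAAG Γ →* RAAG Γ}
    (hψ : ∀ v, ψ (RAAG.gen Γ v) = RAAG.gen Γ v ^ (δ v : ℤ)) {w u : List (V × ℤˣ)} {v : V}
    (hv : IsExceptional Γ δ w v) (b : RAAG Γ)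
    (hu : raagEval Γ u = b * raagEval Γ w * (ψ b)⁻¹) : v ∈ u.map Prod.fst := by
  classical
  by_contra hvu
  obtain ⟨-, p, e, q, hp, hq, rfl⟩ := hv
  have h := congrArg (vertexParity Γ v) hu
  rw [vertexParity_raagEval_of_forall_ne v u
    (by rintro x hx rfl; exact hvu (List.mem_map_of_mem hx))] at h
  rw [map_mul, map_mul, map_inv, vertexParity_map hψ, mul_inv_cancel_comm, raagEval_append,
    raagEval_cons, map_mul, map_mul, vertexParity_gen_zpow,
    vertexParity_raagEval_of_forall_ne v p (fun x hx => (hp x hx).ne'),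
    vertexParity_raagEval_of_forall_ne v q (fun x hx => (hq x hx).ne')] at h
  simp at h

theorem IsExceptional.count_eq_one [DecidableEq V] {δ : V → ℤˣ} {w : List (V × ℤˣ)} {v : V}
    (hv : IsExceptional Γ δ w v) : (w.map Prod.fst).count v = 1 := by
  obtain ⟨-, p, e, q, hp, hq, rfl⟩ := hv
  have h : ∀ l : List (V × ℤˣ), (∀ z ∈ l, Γ.Adj v z.1) → (l.map Prod.fst).count v = 0 := by
    intro l hl
    rw [List.count_eq_zero, List.mem_map]
    rintro ⟨x, hx, rfl⟩
    exact (hl x hx).ne rfl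
  simp [h p hp, h q hq]

theorem IsExceptional.adj {δ : V → ℤˣ} {w : List (V × ℤˣ)} {v : V}
    (hv : IsExceptional Γ δ w v) {x : V × ℤˣ} (hx : x ∈ w) (hne : x.1 ≠ v) : Γ.Adj v x.1 := by
  obtain ⟨-, p, e, q, hp, hq, rfl⟩ := hv
  rcases List.mem_append.mp hx with h | h
  · exact hp x h
  · rcases List.mem_cons.mp h with rfl | h
    · exact absurd rfl hne
    · exact hq x h

theorem List.exists_of_filter_eq_append_cons {α : Type*} {f : α → Bool} {l p r : List α} {x : α}
    (h : l.filter f = p ++ x :: r) :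
    ∃ P R, l = P ++ x :: R ∧ P.filter f = p ∧ R.filter f = r ∧ f x = true := by
  rw [List.filter_eq_append_iff] at h
  obtain ⟨l₁, l₂, rfl, h₁, h₂⟩ := h
  rw [List.filter_eq_cons_iff] at h₂
  obtain ⟨l₃, l₄, rfl, h₃, hx, h₄⟩ := h₂
  refine ⟨l₁ ++ l₃, l₄, by simp, ?_, h₄, hx⟩
  rw [List.filter_append, h₁, List.filter_eq_nil_iff.mpr h₃, List.append_nil]

/-- A reduced and twisted cyclically reduced word has minimal length in its twisted conjugacy
class. The exceptional letters are counted by parity, the other ones by the growth argument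
after the exceptional vertices are killed. -/
theorem length_le_of_twistedConj [Finite V] {δ : V → ℤˣ}
    {ψ : RAAG Γ →* RAAG Γ} (hψ : ∀ v, ψ (RAAG.gen Γ v) = RAAG.gen Γ v ^ (δ v : ℤ))
    {w u : List (V × ℤˣ)} (hw : IsReducedWord Γ w) (hc : IsTwistedCyclicallyReduced Γ δ w)
    (b : RAAG Γ) (hu : raagEval Γ u = b * raagEval Γ w * (ψ b)⁻¹) : w.length ≤ u.length := by
  classical
  let E : Set V := {v | IsExceptional Γ δ w v}
  let f : V × ℤˣ → Bool := fun x => x.1 ∉ E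
  -- Exceptional letters commute with all other letters, so putting them back into a subword of
  -- the filtered word keeps it adjacent to `v`.
  have hadj : ∀ {l : List (V × ℤˣ)} {v : V}, l ⊆ w → v ∉ E → v ∈ w.map Prod.fst →
      (∀ z ∈ l.filter f, Γ.Adj v z.1) → ∀ z ∈ l, Γ.Adj v z.1 := by
    intro l v hl hv hvw h z hz
    by_cases hzE : z.1 ∈ E
    · obtain ⟨x, hx, rfl⟩ := List.mem_map.mp hvw
      exact (IsExceptional.adj hzE hx (by rintro h; exact hv (h ▸ hzE))).symm
    · exact h z (by simp [f, hz, hzE])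
  have hred : IsReducedWord Γ (w.filter f) := by
    intro p x q r hq h
    obtain ⟨P', R, rfl, hP', rfl, -⟩ := List.exists_of_filter_eq_append_cons h
    obtain ⟨P, Q, rfl, rfl, rfl, hx⟩ := List.exists_of_filter_eq_append_cons hP'
    exact hw P x Q R (hadj (by intro; simp; tauto) (by simpa [f] using hx) (by simp) hq) rfl
  have hcyc : IsTwistedCyclicallyReduced Γ δ (w.filter f) := by
    intro p y s r hp hr h
    obtain ⟨P', R, rfl, hP', rfl, -⟩ := List.exists_of_filter_eq_append_cons h
    obtain ⟨P, S, rfl, rfl, rfl, hy⟩ := List.exists_of_filter_eq_append_cons hP'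
    have hyE : y.1 ∉ E := by simpa [f] using hy
    exact hc P y S R (hadj (by intro; simp; tauto) hyE (by simp) hp)
      (hadj (by intro; simp; tauto) hyE (by simp) hr) rfl
  have hexc : ∀ v, ¬ IsExceptional Γ δ (w.filter f) v := by
    rintro v ⟨hδ, p, e, q, hp, hq, h⟩
    obtain ⟨P, Q, hPQ, rfl, rfl, hv⟩ := List.exists_of_filter_eq_append_cons h
    have hvE : v ∉ E := by simpa [f] using hv
    refine hvE ⟨hδ, P, e, Q, hadj ?_ hvE ?_ hp, hadj ?_ hvE ?_ hq, hPQ⟩ <;> simp [hPQ]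
  have hker : (w.filter f).length ≤ (u.filter f).length := by
    have hψk : ∀ g, killVertices Γ E (ψ g) = ψ (killVertices Γ E g) := by
      refine DFunLike.congr_fun (f := (killVertices Γ E).comp ψ) (g := ψ.comp (killVertices Γ E))
        (PresentedGroup.ext fun z => ?_)
      change killVertices Γ E (ψ (RAAG.gen Γ z)) = ψ (killVertices Γ E (RAAG.gen Γ z))
      by_cases hz : z ∈ E <;> simp [hψ, killVertices_gen, hz]
    refine length_le_of_twistedConj_of_not_isExceptional hψ hred hcyc hexc
      (killVertices Γ E b) ?_
    have := congrArg (killVertices Γ E) hu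
    simpa [killVertices_raagEval, hψk, f] using this
  have hexcLen : (w.filter fun x => !f x).length ≤ (u.filter fun x => !f x).length := by
    have hmem : ∀ (l : List (V × ℤˣ)) v,
        v ∈ (l.filter fun x => !f x).map Prod.fst ↔ v ∈ l.map Prod.fst ∧ v ∈ E := by
      intro l v
      simp only [List.mem_map, List.mem_filter, f]
      constructor
      · rintro ⟨x, ⟨hx, hE⟩, rfl⟩
        exact ⟨⟨x, hx, rfl⟩, by simpa using hE⟩
      · rintro ⟨⟨x, hx, rfl⟩, hE⟩
        exact ⟨x, ⟨hx, by simpa using hE⟩, rfl⟩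
    have hnd : ((w.filter fun x => !f x).map Prod.fst).Nodup := by
      rw [List.nodup_iff_count_le_one]
      intro v
      by_cases hv : v ∈ E
      · exact ((List.filter_sublist.map Prod.fst).count_le v).trans
          (IsExceptional.count_eq_one hv).le
      · rw [List.count_eq_zero_of_not_mem fun h => hv ((hmem _ _).mp h).2]
        exact zero_le_one
    have hsub : (w.filter fun x => !f x).map Prod.fst ⊆ (u.filter fun x => !f x).map Prod.fst := by
      intro v hv
      have hE := ((hmem _ _).mp hv).2
      exact (hmem _ _).mpr ⟨IsExceptional.mem_of_twistedConj hψ hE b hu, hE⟩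
    simpa using (hnd.subperm hsub).length_le
  rw [List.length_eq_length_filter_add f (l := w), List.length_eq_length_filter_add f (l := u)]
  exact Nat.add_le_add hker hexcLen

end TwistedConjugacy

/-! ### Words in the generators of an extension of a right-angled Artin group -/

section ExtWords

variable {V T : Type*} {Γ : SimpleGraph V} [CommGroup T]

/-- The letters for the generators of an extension `A_Γ ⋊ T`: `Sum.inl (v, e)` stands for
`v ^ e`, and `Sum.inr e` stands for `τ ^ e`, where `τ` is a fixed element of `T` and `e = ± 1`. -/
abbrev ExtLetter (V : Type*) := (V × ℤˣ) ⊕ ℤˣ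

namespace ExtLetter

/-- The image of a letter in `T`. -/
def toT (τ : T) : ExtLetter V → T
  | .inl _ => 1
  | .inr e => τ ^ (e : ℤ)

/-- The element of `A_Γ ⋊ T` that a letter stands for. -/
def val (Γ : SimpleGraph V) (α : T →* MulAut (RAAG Γ)) (τ : T) : ExtLetter V → RAAG Γ ⋊[α] T
  | .inl x => SemidirectProduct.inl (RAAG.gen Γ x.1 ^ (x.2 : ℤ))
  | .inr e => SemidirectProduct.inr (τ ^ (e : ℤ))

/-- A letter that can be moved past the powers of the vertex `v`: a power of `τ` (which changes
the exponent of `v`), or a letter given by a vertex adjacent to `v`. -/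
def Passes (Γ : SimpleGraph V) (v : V) : ExtLetter V → Prop
  | .inl y => Γ.Adj v y.1
  | .inr _ => True

end ExtLetter

/-- The image in `T` of a word. -/
def tExp (τ : T) (w : List (ExtLetter V)) : T := (w.map (ExtLetter.toT τ)).prod

/-- The element of `A_Γ ⋊ T` that a word represents. -/
def extEval (Γ : SimpleGraph V) (α : T →* MulAut (RAAG Γ)) (τ : T) (w : List (ExtLetter V)) :
    RAAG Γ ⋊[α] T :=
  (w.map (ExtLetter.val Γ α τ)).prod

/-- The word of vertex letters that remains when all the letters `τ ^ e` of a word are moved to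
its right end. Here `k ∈ T` acts on `A_Γ` by `v ↦ v ^ f v k`. -/
def untwist (f : V → T →* ℤˣ) (τ : T) : List (ExtLetter V) → List (V × ℤˣ)
  | [] => []
  | .inl x :: w => x :: untwist f τ w
  | .inr e :: w => (untwist f τ w).map (twist fun v => f v (τ ^ (e : ℤ)))

variable (f : V → T →* ℤˣ) (τ : T)

@[simp]
theorem tExp_nil : tExp τ ([] : List (ExtLetter V)) = 1 := rfl

@[simp]
theorem tExp_cons_inl (x : V × ℤˣ) (w : List (ExtLetter V)) :
    tExp τ (.inl x :: w) = tExp τ w := by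
  simp [tExp, ExtLetter.toT]

@[simp]
theorem tExp_cons_inr (e : ℤˣ) (w : List (ExtLetter V)) :
    tExp τ (.inr e :: w) = τ ^ (e : ℤ) * tExp τ w := by
  simp [tExp, ExtLetter.toT]

@[simp]
theorem tExp_append (w w' : List (ExtLetter V)) :
    tExp τ (w ++ w') = tExp τ w * tExp τ w' := by
  simp [tExp]

theorem map_twist_map_twist (k l : T) (w : List (V × ℤˣ)) :
    (w.map (twist fun v => f v l)).map (twist fun v => f v k) =
      w.map (twist fun v => f v (k * l)) := by
  simp [twist, mul_assoc]

theorem map_twist_one (w : List (V × ℤˣ)) : w.map (twist fun v => f v 1) = w :=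
  (List.map_congr_left fun x _ => by simp [twist]).trans (List.map_id w)

theorem length_untwist (w : List (ExtLetter V)) :
    (untwist f τ w).length = w.countP Sum.isLeft := by
  induction w with
  | nil => rfl
  | cons x w ih => rcases x with x | e <;> simp [untwist, ih, List.countP_cons]

theorem length_eq_countP_isLeft_add (w : List (ExtLetter V)) :
    w.length = w.countP Sum.isLeft + w.countP Sum.isRight := by
  induction w with
  | nil => rfl
  | cons x w ih => rcases x with x | e <;> simp [ih, List.countP_cons] <;> omega

theorem forall_mem_untwist_adj {v : V} {w : List (ExtLetter V)} :
    (∀ z ∈ untwist f τ w, Γ.Adj v z.1) ↔ ∀ z ∈ w, ExtLetter.Passes Γ v z := by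
  induction w with
  | nil => simp [untwist]
  | cons x w ih =>
    rcases x with x | e
    · rw [untwist, List.forall_mem_cons, List.forall_mem_cons, ih]
      rfl
    · rw [untwist, forall_mem_map_twist_adj, ih, List.forall_mem_cons]
      exact (and_iff_right trivial).symm

/-- Each letter of `untwist f τ w` comes from a vertex letter of `w`. -/
theorem exists_of_untwist_eq_append_cons {w : List (ExtLetter V)} {p q : List (V × ℤˣ)}
    {x : V × ℤˣ} (h : untwist f τ w = p ++ x :: q) :
    ∃ P y Q, w = P ++ .inl y :: Q ∧ untwist f τ P = p ∧
      twist (fun v => f v (tExp τ P)) y = x ∧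
        (untwist f τ Q).map (twist fun v => f v (tExp τ P)) = q := by
  induction w generalizing p x q with
  | nil => simp [untwist] at h
  | cons z w ih =>
    rcases z with z | e
    · rcases p with _ | ⟨a, p⟩
      · obtain ⟨rfl, rfl⟩ := List.cons_eq_cons.mp h
        exact ⟨[], z, w, rfl, rfl, by simp [twist], map_twist_one f _⟩
      · obtain ⟨rfl, h'⟩ := List.cons_eq_cons.mp h
        obtain ⟨P, y, Q, rfl, rfl, hy, hQ⟩ := ih h'
        exact ⟨.inl z :: P, y, Q, rfl, rfl, by simpa using hy, by simpa using hQ⟩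
    · rw [untwist, List.map_eq_append_iff] at h
      obtain ⟨p', l, h, rfl, hl⟩ := h
      obtain ⟨x', q', rfl, rfl, rfl⟩ := List.map_eq_cons_iff.mp hl
      obtain ⟨P, y, Q, rfl, rfl, rfl, rfl⟩ := ih h
      refine ⟨.inr e :: P, y, Q, rfl, rfl, ?_, ?_⟩
      · simp [twist, mul_assoc]
      · rw [map_twist_map_twist, tExp_cons_inr]

/-- Two vertex letters of the word cancel when the letters between them are moved away. -/
def HasCancellation (Γ : SimpleGraph V) (w : List (ExtLetter V)) : Prop :=
  ∃ p x q y r, w = p ++ .inl x :: q ++ .inl y :: r ∧ (∀ z ∈ q, ExtLetter.Passes Γ x.1 z) ∧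
    y.1 = x.1 ∧ x.2 = -(f x.1 (tExp τ q) * y.2)

variable {f τ}

theorem isReducedWord_untwist {w : List (ExtLetter V)} (h : ¬ HasCancellation f τ Γ w) :
    IsReducedWord Γ (untwist f τ w) := by
  intro p x q r hq e
  obtain ⟨P', y', R, rfl, hP', hy', -⟩ := exists_of_untwist_eq_append_cons f τ e
  obtain ⟨P, y, Q, rfl, rfl, rfl, rfl⟩ := exists_of_untwist_eq_append_cons f τ hP'
  rw [Prod.ext_iff] at hy'
  obtain ⟨hv, he⟩ := hy'
  rw [forall_mem_map_twist_adj, forall_mem_untwist_adj] at hq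
  refine h ⟨P, y, Q, y', R, rfl, hq, hv, ?_⟩
  simp only [twist] at hv he ⊢
  rw [hv, tExp_append, tExp_cons_inl, map_mul] at he
  generalize f y.1 (tExp τ P) = a at he
  generalize f y.1 (tExp τ Q) = b at he ⊢
  generalize y.2 = c at he ⊢
  generalize y'.2 = d at he ⊢
  revert a b c d
  decide

theorem isTwistedCyclicallyReduced_untwist {w : List (ExtLetter V)}
    (h : ∀ a b, w = a ++ b → ¬ HasCancellation f τ Γ (b ++ a)) :
    IsTwistedCyclicallyReduced Γ (fun v => f v (tExp τ w)) (untwist f τ w) := by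
  intro p x q r hp hr e
  obtain ⟨P', y', R, rfl, hP', hy', rfl⟩ := exists_of_untwist_eq_append_cons f τ e
  obtain ⟨P, y, Q, rfl, rfl, rfl, rfl⟩ := exists_of_untwist_eq_append_cons f τ hP'
  rw [Prod.ext_iff] at hy'
  obtain ⟨hv, he⟩ := hy'
  rw [forall_mem_map_twist_adj, forall_mem_untwist_adj] at hr
  rw [forall_mem_untwist_adj] at hp
  simp only [twist] at hv he hp hr
  refine h (P ++ .inl y :: Q) (.inl y' :: R) rfl ⟨[], y', R ++ P, y, Q, by simp, ?_, hv.symm, ?_⟩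
  · rw [hv]
    intro z hz
    rcases List.mem_append.mp hz with hz | hz
    · exact hr z hz
    · exact hp z hz
  · simp only [tExp_append, tExp_cons_inl, map_mul, hv] at he ⊢
    generalize f y.1 (tExp τ P) = a at he ⊢
    generalize f y.1 (tExp τ Q) = b at he
    generalize f y.1 (tExp τ R) = b' at he ⊢
    generalize y.2 = c at he ⊢
    generalize y'.2 = d at he ⊢
    revert a b b' c d
    decide

theorem IsTwistedCyclicallyReduced.map_twist {δ : V → ℤˣ} {w : List (V × ℤˣ)}
    (h : IsTwistedCyclicallyReduced Γ δ w) (ε : V → ℤˣ) :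
    IsTwistedCyclicallyReduced Γ δ (w.map (twist ε)) := by
  intro p y s r hp hr e
  refine h (p.map (twist ε)) (twist ε y) (s.map (twist ε)) (r.map (twist ε))
    (forall_mem_map_twist_adj.mpr hp) (forall_mem_map_twist_adj.mpr hr) ?_
  rw [eq_map_twist_of_map_twist_eq e]
  simp [twist, mul_left_comm]

/-! ### Conjugacy geodesics in the extension -/

variable {α : T →* MulAut (RAAG Γ)}

theorem extEval_append (w w' : List (ExtLetter V)) :
    extEval Γ α τ (w ++ w') = extEval Γ α τ w * extEval Γ α τ w' := by
  simp [extEval]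

theorem extEval_cons (x : ExtLetter V) (w : List (ExtLetter V)) :
    extEval Γ α τ (x :: w) = x.val Γ α τ * extEval Γ α τ w := by
  simp [extEval]

theorem inr_mul_inl (k : T) (g : RAAG Γ) :
    (SemidirectProduct.inr k * SemidirectProduct.inl g : RAAG Γ ⋊[α] T) =
      SemidirectProduct.inl (α k g) * SemidirectProduct.inr k := by
  rw [SemidirectProduct.inl_aut]
  simp

theorem action_raagEval (hα : ∀ k v, α k (RAAG.gen Γ v) = RAAG.gen Γ v ^ (f v k : ℤ)) (k : T)
    (w : List (V × ℤˣ)) :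
    α k (raagEval Γ w) = raagEval Γ (w.map (twist fun v => f v k)) :=
  map_raagEval (ψ := (α k).toMonoidHom) (hα k) w

theorem extEval_eq (hα : ∀ k v, α k (RAAG.gen Γ v) = RAAG.gen Γ v ^ (f v k : ℤ))
    (w : List (ExtLetter V)) :
    extEval Γ α τ w =
      SemidirectProduct.inl (raagEval Γ (untwist f τ w)) * SemidirectProduct.inr (tExp τ w) := by
  induction w with
  | nil => simp [extEval, untwist]
  | cons x w ih =>
    rw [extEval_cons, ih]
    rcases x with x | e
    · simp [ExtLetter.val, untwist, mul_assoc]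
    · rw [ExtLetter.val, ← mul_assoc, inr_mul_inl, action_raagEval hα, mul_assoc, ← map_mul,
        tExp_cons_inr, untwist]

theorem extEval_map_inl (w : List (V × ℤˣ)) :
    extEval Γ α τ (w.map .inl) = SemidirectProduct.inl (raagEval Γ w) := by
  induction w with
  | nil => simp [extEval]
  | cons x w ih => simp [extEval_cons, ih, ExtLetter.val]

theorem extEval_filter_isRight (w : List (ExtLetter V)) :
    extEval Γ α τ (w.filter Sum.isRight) = SemidirectProduct.inr (tExp τ w) := by
  induction w with
  | nil => simp [extEval]
  | cons x w ih =>
    rcases x with x | e <;> simp [List.filter_cons, extEval_cons, ih, ExtLetter.val]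

theorem extEval_mul_inl_gen (hα : ∀ k v, α k (RAAG.gen Γ v) = RAAG.gen Γ v ^ (f v k : ℤ))
    {v : V} {q : List (ExtLetter V)} (hq : ∀ z ∈ q, ExtLetter.Passes Γ v z) (e : ℤˣ) :
    extEval Γ α τ q * SemidirectProduct.inl (RAAG.gen Γ v ^ (e : ℤ)) =
      SemidirectProduct.inl (RAAG.gen Γ v ^ ((f v (tExp τ q) * e : ℤˣ) : ℤ)) *
        extEval Γ α τ q := by
  induction q with
  | nil => simp [extEval]
  | cons x q ih =>
    rw [List.forall_mem_cons] at hq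
    rw [extEval_cons, mul_assoc, ih hq.2, ← mul_assoc, ← mul_assoc]
    congr 1
    rcases x with x | d
    · rw [ExtLetter.val, tExp_cons_inl, ← map_mul, ← map_mul]
      exact congrArg _ ((RAAG.commute_gen (show Γ.Adj v x.1 from hq.1)).zpow_zpow _ _).eq.symm
    · rw [ExtLetter.val, inr_mul_inl, map_zpow, hα, tExp_cons_inr, map_mul, ← zpow_mul,
        mul_assoc, ← Units.val_mul]

theorem HasCancellation.exists_shorter
    (hα : ∀ k v, α k (RAAG.gen Γ v) = RAAG.gen Γ v ^ (f v k : ℤ)) {w : List (ExtLetter V)}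
    (h : HasCancellation f τ Γ w) :
    ∃ u, u.length < w.length ∧ extEval Γ α τ u = extEval Γ α τ w := by
  obtain ⟨p, x, q, y, r, rfl, hq, hv, he⟩ := h
  refine ⟨p ++ q ++ r, by simp, ?_⟩
  rw [extEval_append, extEval_append, extEval_append, extEval_append, extEval_cons, extEval_cons,
    mul_assoc, mul_assoc, mul_assoc]
  congr 1
  rw [← mul_assoc (extEval Γ α τ q), ExtLetter.val, ExtLetter.val, hv, extEval_mul_inl_gen hα hq,
    he, ← mul_assoc, ← mul_assoc, ← map_mul]
  simp

/-- A word is a conjugacy geodesic if no word representing a conjugate element is shorter. -/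
def IsConjGeodesic (Γ : SimpleGraph V) (α : T →* MulAut (RAAG Γ)) (τ : T)
    (w : List (ExtLetter V)) : Prop :=
  ∀ u, IsConj (extEval Γ α τ w) (extEval Γ α τ u) → w.length ≤ u.length

/-- A word is a conjugacy geodesic if and only if its number of letters `τ ^ e` is least possible
for its image in `T` and no cyclic permutation of it has a cancellation. -/
theorem isConjGeodesic_iff [Finite V]
    (hα : ∀ k v, α k (RAAG.gen Γ v) = RAAG.gen Γ v ^ (f v k : ℤ)) (w : List (ExtLetter V)) :
    IsConjGeodesic Γ α τ w ↔
      (∀ u : List (ExtLetter V), tExp τ u = tExp τ w →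
        w.countP Sum.isRight ≤ u.countP Sum.isRight) ∧
      ∀ a b, w = a ++ b → ¬ HasCancellation f τ Γ (b ++ a) := by
  constructor
  · intro h
    constructor
    · intro u hu
      have := h ((untwist f τ w).map .inl ++ u.filter Sum.isRight) (by
        rw [extEval_append, extEval_map_inl, extEval_filter_isRight, hu, ← extEval_eq hα])
      rw [List.length_append, List.length_map, length_untwist, ← List.countP_eq_length_filter,
        length_eq_countP_isLeft_add w] at this
      omega
    · rintro a b rfl hc
      obtain ⟨u, hlt, hu⟩ := hc.exists_shorter hα
      refine (h u ?_).not_gt (by simpa [add_comm] using hlt)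
      rw [hu, extEval_append, extEval_append, isConj_iff]
      exact ⟨(extEval Γ α τ a)⁻¹, by group⟩
  · rintro ⟨hT, hC⟩ u hu
    obtain ⟨c, hc⟩ := isConj_iff.mp hu
    have hright : tExp τ u = tExp τ w := by
      have := congrArg SemidirectProduct.right hc
      simpa [extEval_eq hα] using this.symm
    have hleft : raagEval Γ (untwist f τ u) =
        c.left * raagEval Γ ((untwist f τ w).map (twist fun v => f v c.right)) *
          (α (tExp τ w) c.left)⁻¹ := by
      have := congrArg SemidirectProduct.left hc
      rw [extEval_eq hα, extEval_eq hα] at this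
      simp only [SemidirectProduct.mul_left, SemidirectProduct.mul_right,
        SemidirectProduct.inv_left, SemidirectProduct.left_inl, SemidirectProduct.right_inl,
        SemidirectProduct.left_inr, SemidirectProduct.right_inr, map_one, mul_one, one_mul] at this
      rw [← this, ← action_raagEval hα, ← MulAut.mul_apply, ← map_mul, mul_right_comm,
        mul_inv_cancel, one_mul, map_inv]
    have h₁ := length_le_of_twistedConj (ψ := (α (tExp τ w)).toMonoidHom) (hα (tExp τ w))
      ((isReducedWord_untwist (by simpa using hC w [] (by simp))).map_twist fun v => f v c.right)
      ((isTwistedCyclicallyReduced_untwist hC).map_twist fun v => f v c.right) c.left hleft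
    rw [List.length_map, length_untwist, length_untwist] at h₁
    rw [length_eq_countP_isLeft_add w, length_eq_countP_isLeft_add u]
    exact Nat.add_le_add h₁ (hT u hright)

theorem isRegular_hasCancellation [Finite V] [Finite T] :
    Language.IsRegular ({w | HasCancellation f τ Γ w} : Language (ExtLetter V)) := by
  have hK : ∀ i : (V × ℤˣ) × (V × ℤˣ), Language.IsRegular
      ({q | (∀ z ∈ q, ExtLetter.Passes Γ i.1.1 z) ∧
        i.2.1 = i.1.1 ∧ i.1.2 = -(f i.1.1 (tExp τ q) * i.2.2)} : Language (ExtLetter V)) :=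
    fun i => ((Language.IsRegular.forall_mem (ExtLetter.Passes Γ i.1.1)).inf
      (Language.IsRegular.of_monoid (ExtLetter.toT τ)
        {k | i.2.1 = i.1.1 ∧ i.1.2 = -(f i.1.1 k * i.2.2)})).congr fun w => Iff.rfl
  refine (Language.IsRegular.exists fun i : (V × ℤˣ) × (V × ℤˣ) =>
    ((((Language.IsRegular.top.mul (.singleton_letter (.inl i.1))).mul (hK i)).mul
      (.singleton_letter (.inl i.2))).mul .top)).congr fun w => ?_
  constructor
  · rintro ⟨p, x, q, y, r, rfl, hq⟩
    refine ⟨(x, y), Language.mem_mul.mpr ⟨p ++ [.inl x] ++ q ++ [.inl y], ?_, r, trivial, by simp⟩⟩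
    refine Language.mem_mul.mpr ⟨p ++ [.inl x] ++ q, ?_, [.inl y], rfl, rfl⟩
    refine Language.mem_mul.mpr ⟨p ++ [.inl x], ?_, q, hq, rfl⟩
    exact Language.mem_mul.mpr ⟨p, trivial, [.inl x], rfl, rfl⟩
  · rintro ⟨⟨x, y⟩, h⟩
    obtain ⟨a₁, h₁, r, -, rfl⟩ := Language.mem_mul.mp h
    obtain ⟨a₂, h₂, b, hb, rfl⟩ := Language.mem_mul.mp h₁
    obtain ⟨a₃, h₃, q, hq, rfl⟩ := Language.mem_mul.mp h₂
    obtain ⟨p, -, c, hc, rfl⟩ := Language.mem_mul.mp h₃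
    obtain rfl : b = [.inl y] := hb
    obtain rfl : c = [.inl x] := hc
    exact ⟨p, x, q, y, r, by simp, hq⟩

theorem isRegular_isConjGeodesic [Finite V] [Finite T]
    (hα : ∀ k v, α k (RAAG.gen Γ v) = RAAG.gen Γ v ^ (f v k : ℤ)) :
    Language.IsRegular ({w | IsConjGeodesic Γ α τ w} : Language (ExtLetter V)) := by
  let μ : T → ℕ := fun k => sInf {n | ∃ u : List (ExtLetter V), tExp τ u = k ∧
    u.countP Sum.isRight = n}
  have hT : Language.IsRegular ({w | w.countP Sum.isRight = μ (tExp τ w)} :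
      Language (ExtLetter V)) := by
    refine (Language.IsRegular.exists fun k : T =>
      (Language.IsRegular.of_monoid (ExtLetter.toT τ) {k}).inf
        (Language.IsRegular.countP_eq Sum.isRight (μ k))).congr fun w => ?_
    exact ⟨fun h => ⟨tExp τ w, rfl, h⟩, by rintro ⟨_, rfl, h⟩; exact h⟩
  refine (hT.inf (isRegular_hasCancellation (f := f) (τ := τ) (Γ := Γ)).cyclicShift.compl).congr
    fun w => ?_
  refine (isConjGeodesic_iff hα w).trans (and_congr ?_ ?_)
  · constructor
    · intro h
      refine le_antisymm (le_csInf ⟨_, w, rfl, rfl⟩ ?_) (Nat.sInf_le ⟨w, rfl, rfl⟩)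
      rintro _ ⟨u, hu, rfl⟩
      exact h u hu
    · intro h u hu
      exact h.trans_le (Nat.sInf_le ⟨u, hu, rfl⟩)
  · exact ⟨fun h ⟨a, b, hw, hc⟩ => h a b hw hc, fun h a b hw hc => h ⟨a, b, hw, hc⟩⟩

end ExtWords

/-! ### The action of a composition of inversions -/

section Inversions

variable {V : Type*} {Γ : SimpleGraph V}

theorem RAAG.gen_zpow_units_injective (v : V) {d e : ℤˣ}
    (h : RAAG.gen Γ v ^ (d : ℤ) = RAAG.gen Γ v ^ (e : ℤ)) : d = e := by
  let σ : RAAG Γ →* Multiplicative ℤ :=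
    PresentedGroup.toGroup (f := fun _ => Multiplicative.ofAdd 1) (by
      rintro _ ⟨a, b, -, rfl⟩
      simp)
  have hσ : σ (RAAG.gen Γ v) = Multiplicative.ofAdd 1 := PresentedGroup.toGroup.of _
  have := congrArg σ h
  rw [map_zpow, map_zpow, hσ, ← ofAdd_zsmul, ← ofAdd_zsmul] at this
  exact Units.ext (by simpa using this)

/-- The automorphisms of `A_Γ` that send each vertex to itself or to its inverse. -/
def signAut (Γ : SimpleGraph V) : Subgroup (MulAut (RAAG Γ)) where
  carrier := {ψ | ∀ v, ∃ e : ℤˣ, ψ (RAAG.gen Γ v) = RAAG.gen Γ v ^ (e : ℤ)}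
  one_mem' v := ⟨1, by simp⟩
  mul_mem' {ψ χ} hψ hχ v := by
    obtain ⟨d, hd⟩ := hψ v
    obtain ⟨e, he⟩ := hχ v
    exact ⟨d * e, by rw [MulAut.mul_apply, he, map_zpow, hd, ← zpow_mul, Units.val_mul]⟩
  inv_mem' {ψ} hψ v := by
    obtain ⟨e, he⟩ := hψ v
    refine ⟨e, ψ.injective ?_⟩
    rw [MulAut.apply_inv_self, map_zpow, he, ← zpow_mul, ← Units.val_mul]
    simp

theorem IsCompositionOfInversions.mem_signAut {φ : MulAut (RAAG Γ)}
    (h : IsCompositionOfInversions φ) : φ ∈ signAut Γ := by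
  obtain ⟨l, hl, rfl⟩ := h
  refine list_prod_mem fun ψ hψ v => ?_
  obtain ⟨x, hx, hy⟩ := hl ψ hψ
  by_cases h : v = x
  · exact ⟨-1, by simp [h, hx]⟩
  · exact ⟨1, by simp [hy v h]⟩

/-- An action on `A_Γ` by automorphisms that invert or fix each vertex is given by a character
for each vertex. -/
theorem exists_characters {T : Type*} [Group T] (α : T →* MulAut (RAAG Γ))
    (h : ∀ k, α k ∈ signAut Γ) :
    ∃ f : V → T →* ℤˣ, ∀ k v, α k (RAAG.gen Γ v) = RAAG.gen Γ v ^ (f v k : ℤ) := by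
  choose f hf using h
  refine ⟨fun v => MonoidHom.mk' (fun k => f k v) fun k l => ?_, hf⟩
  refine RAAG.gen_zpow_units_injective (Γ := Γ) v ?_
  rw [← hf, map_mul, MulAut.mul_apply, hf, map_zpow, hf, ← zpow_mul, Units.val_mul]

theorem cyclicAction_mem_signAut {m : ℕ} [NeZero m] {φ : MulAut (RAAG Γ)} (hφ : φ ^ m = 1)
    (h : φ ∈ signAut Γ) (k : Multiplicative (ZMod m)) : cyclicAction m φ hφ k ∈ signAut Γ := by
  have hk : k = Multiplicative.ofAdd (1 : ZMod m) ^ (Multiplicative.toAdd k).val := by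
    rw [← ofAdd_nsmul]
    simp
  rw [hk, map_pow, cyclicAction_ofAdd_one]
  exact pow_mem (inv_mem h) _

end Inversions

/-! ### The language of conjugacy geodesics -/

section ConjGeo

theorem wordEval_surjective {G : Type*} [Group G] {X : Set G} (hX : Submonoid.closure X = ⊤) :
    Function.Surjective (wordEval X) := by
  intro g
  obtain ⟨l, hl, rfl⟩ := Submonoid.exists_list_of_mem_closure (hX ▸ Submonoid.mem_top g)
  lift l to List X using hl
  exact ⟨l, rfl⟩

theorem mem_conjGeo_iff {G : Type*} [Group G] {X : Set G} (hX : Submonoid.closure X = ⊤)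
    (w : List X) : w ∈ ConjGeo X ↔
      ∀ u : List X, IsConj (wordEval X w) (wordEval X u) → w.length ≤ u.length := by
  have hle : ∀ u : List X, wordLength X (wordEval X u) ≤ u.length :=
    fun u => Nat.sInf_le ⟨u, rfl, rfl⟩
  have hne : {n : ℕ | ∃ h : G, IsConj (wordEval X w) h ∧ wordLength X h = n}.Nonempty :=
    ⟨_, _, IsConj.refl _, rfl⟩
  change w.length = conjLength X _ ↔ _
  constructor
  · intro h u hu
    rw [h]
    exact (Nat.sInf_le ⟨_, hu, rfl⟩ : conjLength X _ ≤ _).trans (hle u)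
  · intro h
    refine le_antisymm (le_csInf hne ?_)
      ((Nat.sInf_le ⟨_, IsConj.refl _, rfl⟩ : conjLength X _ ≤ _).trans (hle w))
    rintro _ ⟨g, hg, rfl⟩
    obtain ⟨u₀, hu₀⟩ := wordEval_surjective hX g
    refine le_csInf ⟨_, u₀, hu₀, rfl⟩ ?_
    rintro _ ⟨u, rfl, rfl⟩
    exact h u hg

theorem VirtualRAAG.range_extLetter_val {V : Type*} {Γ : SimpleGraph V} (m : ℕ)
    (φ : MulAut (RAAG Γ)) (hφ : φ ^ m = 1) :
    Set.range (ExtLetter.val Γ (cyclicAction m φ hφ) (Multiplicative.ofAdd 1)) =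
      stdGen m φ hφ := by
  ext g
  constructor
  · rintro ⟨⟨v, e⟩ | e, rfl⟩ <;> obtain rfl | rfl := Int.units_eq_one_or e
    · exact .inl ⟨v, .inl (by simp [ExtLetter.val, s])⟩
    · exact .inl ⟨v, .inr (by simp [ExtLetter.val, s])⟩
    · exact .inr (.inl (by simp [ExtLetter.val, t]))
    · exact .inr (.inr (by simp [ExtLetter.val, t]))
  · rintro (⟨v, rfl | rfl⟩ | rfl | rfl)
    · exact ⟨.inl (v, 1), by simp [ExtLetter.val, s]⟩
    · exact ⟨.inl (v, -1), by simp [ExtLetter.val, s]⟩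
    · exact ⟨.inr 1, by simp [ExtLetter.val, t]⟩
    · exact ⟨.inr (-1), by simp [ExtLetter.val, t]⟩

end ConjGeo

theorem mainTheorem3 {V : Type*} [Finite V] (Γ : SimpleGraph V) (m : ℕ) [NeZero m]
    (φ : MulAut (RAAG Γ)) (hφ : φ ^ m = 1) (hinv : IsCompositionOfInversions φ) :
    (ConjGeo (VirtualRAAG.stdGen m φ hφ)).IsRegular := by
  set X := VirtualRAAG.stdGen m φ hφ with hXdef
  set τ : Multiplicative (ZMod m) := Multiplicative.ofAdd 1 with hτ
  have : Finite (Multiplicative (ZMod m)) := inferInstanceAs (Finite (ZMod m))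
  obtain ⟨f, hα⟩ := exists_characters (cyclicAction m φ hφ)
    (cyclicAction_mem_signAut hφ hinv.mem_signAut)
  have hX : Set.range (ExtLetter.val Γ (cyclicAction m φ hφ) τ) = X :=
    VirtualRAAG.range_extLetter_val m φ hφ
  -- For small `m` several letters stand for the same generator, so a letter is chosen for each
  -- generator; being a conjugacy geodesic does not depend on this choice.
  have hdec : ∀ x : X, ∃ a, ExtLetter.val Γ (cyclicAction m φ hφ) τ a = x := fun x => by
    simpa [← hX] using x.2
  choose d hd using hdec
  have hmap : ∀ w : List X, extEval Γ (cyclicAction m φ hφ) τ (w.map d) = wordEval X w := by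
    intro w
    simp [extEval, wordEval, Function.comp_def, hd]
  refine ((isRegular_isConjGeodesic (τ := τ) hα).preimage_map d).congr fun w => ?_
  rw [mem_conjGeo_iff (VirtualRAAG.closure_stdGen m φ hφ)]
  constructor
  · intro h u hu
    let u' : List X := u.map fun a => ⟨_, hX ▸ Set.mem_range_self a⟩
    have hu' : wordEval X u' = extEval Γ (cyclicAction m φ hφ) τ u := by
      simp [u', wordEval, extEval, Function.comp_def]
    rw [hmap, ← hu'] at hu
    simpa [u'] using h u' hu
  · intro h u hu
    simpa using h (u.map d) (by rwa [hmap, hmap])
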